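/- For a finite group $G$ and a subset $S\subseteq G$ with $S^{-1}=S$ and $1\notin S$, the Cayley graph $\mathrm{Cay}(G,S)$ is the graph with vertex set $G$ and edge set $\{\{g,sg\}: g\in G,\ s\in S\}$. A finite graph is integral if all eigenvalues of its adjacency matrix are integers. Let $\mathcal{A}_3$ be the class of finite groups $G$ all of whose Cayley graphs $\mathrm{Cay}(G,S)$ of valency $|S|=3$ are integral. (If no such $S$ exists, this condition is regarded as satisfied; the statement therefore holds a fortiori when one moreover requires of the members of $\mathcal{A}_3$ that such an $S$ exists.) Let $G\in\mathcal{A}_3$. Then $G$ has a subgroup isomorphic to the symmetric group $S_3$ if and only if $G\cong S_3$. Moreover, the dihedral groups $D_8$ and $D_{12}$ of orders $8$ and $12$ do not belong to $\mathcal{A}_3$. -/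

import Mathlib

open scoped Pointwise

/-- The Cayley graph `Cay(G, S)`: the vertex set is `G` and the edges are the pairs `{g, s * g}` with
`g ∈ G` and `s ∈ S`.  It is used for symmetric `S` with `1 ∉ S`. -/
def cayleyGraph {G : Type*} [Group G] (S : Set G) : SimpleGraph G :=
  SimpleGraph.fromRel fun g h => ∃ s ∈ S, h = s * g

open Classical in
/-- A finite graph is integral if all eigenvalues of its adjacency matrix, taken over the complex
numbers, are integers. -/
def IsIntegralGraph {V : Type*} [Fintype V] (Γ : SimpleGraph V) : Prop :=
  ∀ μ : ℂ, Module.End.HasEigenvalue (Matrix.toLin' (Γ.adjMatrix ℂ)) μ → ∃ n : ℤ, μ = n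

/-- The class `𝒜ₖ`: the finite groups `G` all of whose Cayley graphs `Cay(G, S)` of valency `k`
(that is, `S` is symmetric, does not contain the identity and has `k` elements) are integral. -/
def ClassA (k : ℕ) (G : Type*) [Group G] [Fintype G] : Prop :=
  ∀ S : Set G, S⁻¹ = S → (1 : G) ∉ S → S.ncard = k → IsIntegralGraph (cayleyGraph S)

/-!
The adjacency operator of `Cay(G, {a, b, c})` is left multiplication by `a + b + c` on the group
algebra `ℂ[G]`. Hence, in a group of class `𝒜₃`, a nonzero `v` with `(a + b + c - k)² v = d v` and
`k` an integer forces `d` to be the square of an integer (`ClassA.exists_int_sq`). Every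
restriction on the group comes from a vector `v` in `ℂ[G]` on which some connection set has a
nonintegral eigenvalue; such vectors are written down directly, without representations of the
group.

For involutions `x`, `y` with product `p = xy` of order `n`, the sets `{x, y, p²}` for `n = 4`,
`{x, y, p³}` for `n = 6` and `{x, xp, xp⁻¹}` for other `n ≥ 5` give the eigenvalues `-1 ± √2`,
`-1 ± √3` and `±(1 + 2 cos (2π / n))`, so `p² = 1` or `p³ = 1`
(`ClassA.sq_eq_one_or_cube_eq_one`). This already excludes the dihedral groups of orders 8 and 12.

Let now `x`, `y` be noncommuting involutions of a group of class `𝒜₃`; they generate a copy of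
`S₃`.
* An element `c` commuting with both is trivial (`ClassA.eq_one_of_comm`): if its order is even, a
  power of it is an involution and gives a product of two involutions of order 6; if it is odd and
  at least 5, use `{x, c, c⁻¹}` with eigenvalue `1 + 2 cos (2π / n)`; if it is 3, use
  `{x, yc, yc⁻¹}` with eigenvalues `±√3`.
* Every involution `z` is one of `x`, `y`, `xyx` (`ClassA.mem_of_mul_self`). If `z` commutes with
  exactly one of them, the Coxeter relations of `S₄` hold and contradict the restriction on products
  of two involutions. If `z` commutes with none of them, the commutator of `xy` and `xz` centralizes
  `x` and `y`, so it is trivial; then `⟨x, y, z⟩` is a generalized dihedral group over `(ℤ/3)²` and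
  `{x, y, z}` has the eigenvalues `±√3`.

Thus conjugation by any element permutes `x`, `y`, `xyx`, and correcting it by an element of
`⟨x, y⟩` one lands in the trivial centralizer; so `⟨x, y⟩` is the whole group
(`ClassA.closure_eq_top`).
-/

/-! ### Integrality of eigenvalues in the group algebra -/

section Eigenvalues

variable {G : Type*} [Group G] [Fintype G]

/-- The vertex set of the Cayley graph is identified with the basis of the group algebra, so that
left multiplication by `a + b + c` is the adjacency operator. -/
theorem ClassA.exists_int_of_mul_eq_smul (hG : ClassA 3 G) {a b c : G}
    (hab : a ≠ b) (hac : a ≠ c) (hbc : b ≠ c) (ha : a ≠ 1) (hb : b ≠ 1) (hc : c ≠ 1)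
    (hinv : ({a, b, c} : Set G)⁻¹ = {a, b, c}) {v : MonoidAlgebra ℂ G} (hv : v ≠ 0) {l : ℂ}
    (h : (.of ℂ G a + .of ℂ G b + .of ℂ G c) * v = l • v) : ∃ n : ℤ, l = n := by
  classical
  have hone : (1 : G) ∉ ({a, b, c} : Set G) := by simp [ha.symm, hb.symm, hc.symm]
  have hadj : ∀ g h, (cayleyGraph ({a, b, c} : Set G)).Adj g h ↔
      h = a⁻¹ * g ∨ h = b⁻¹ * g ∨ h = c⁻¹ * g := by
    intro g h
    have key : ∀ g h : G, (∃ s ∈ ({a, b, c} : Set G), h = s * g) ↔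
        (h = a⁻¹ * g ∨ h = b⁻¹ * g ∨ h = c⁻¹ * g) := by
      intro g h
      rw [← hinv]
      simp only [Set.inv_insert, Set.inv_singleton, Set.mem_insert_iff, Set.mem_singleton_iff,
        exists_eq_or_imp, exists_eq_left]
    have key2 : ∀ g h : G, (∃ s ∈ ({a, b, c} : Set G), g = s * h) ↔
        (h = a⁻¹ * g ∨ h = b⁻¹ * g ∨ h = c⁻¹ * g) := by
      intro g h
      simp [eq_inv_mul_iff_mul_eq, eq_comm]
    rw [cayleyGraph, SimpleGraph.fromRel_adj, key g h, key2 g h, or_self, and_iff_right_iff_imp]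
    rintro (h | h | h) rfl <;> simp_all
  have hcard : ({a, b, c} : Set G).ncard = 3 := Set.ncard_eq_three.mpr ⟨a, b, c, hab, hac, hbc, rfl⟩
  refine hG _ hinv hone hcard l ?_
  refine Module.End.hasEigenvalue_of_hasEigenvector (x := fun g => v.coeff g) ⟨?_, ?_⟩
  · rw [Module.End.mem_eigenspace_iff]
    ext g
    have hg := congrArg (fun u => u.coeff g) h
    simp only [add_mul, MonoidAlgebra.of_apply, MonoidAlgebra.coeff_add, Finsupp.add_apply,
      MonoidAlgebra.coeff_single_mul_apply, one_mul, MonoidAlgebra.coeff_smul_apply] at hg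
    rw [Matrix.toLin'_apply, SimpleGraph.adjMatrix_mulVec_apply, Pi.smul_apply, ← hg]
    have hN : (cayleyGraph ({a, b, c} : Set G)).neighborFinset g =
        {a⁻¹ * g, b⁻¹ * g, c⁻¹ * g} := by
      ext h
      simp [hadj]
    rw [hN, Finset.sum_insert (by simp [hab, hac]), Finset.sum_insert (by simp [hbc]),
      Finset.sum_singleton, add_assoc]
  · intro h0
    apply hv
    rw [← MonoidAlgebra.coeff_eq_zero]
    ext g
    exact congrFun h0 g

/-- If left multiplication by `a + b + c` preserves the span of `v` and `w`, acting there by the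
matrix `[k d; 1 k]`, then its eigenvalues `k ± √d` are integers. -/
theorem ClassA.exists_int_sq (hG : ClassA 3 G) {a b c : G}
    (hab : a ≠ b) (hac : a ≠ c) (hbc : b ≠ c) (ha : a ≠ 1) (hb : b ≠ 1) (hc : c ≠ 1)
    (hinv : ({a, b, c} : Set G)⁻¹ = {a, b, c}) {v w : MonoidAlgebra ℂ G} (hv : v ≠ 0) {d : ℂ}
    (k : ℤ)
    (h1 : (.of ℂ G a + .of ℂ G b + .of ℂ G c) * v = (k : ℂ) • v + w)
    (h2 : (.of ℂ G a + .of ℂ G b + .of ℂ G c) * w = (k : ℂ) • w + d • v) :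
    ∃ n : ℤ, d = (n : ℂ) ^ 2 := by
  obtain ⟨μ, rfl⟩ := IsAlgClosed.exists_pow_nat_eq d (n := 2) two_pos
  by_cases hw : w + μ • v = 0
  · obtain ⟨n, hn⟩ := hG.exists_int_of_mul_eq_smul hab hac hbc ha hb hc hinv hv (l := k - μ) (by
      rw [h1, eq_neg_of_add_eq_zero_left hw]
      module)
    exact ⟨k - n, by push_cast; rw [← hn]; ring⟩
  · obtain ⟨n, hn⟩ := hG.exists_int_of_mul_eq_smul hab hac hbc ha hb hc hinv hw (l := k + μ) (by
      rw [mul_add, mul_smul_comm, h1, h2]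
      module)
    exact ⟨n - k, by push_cast; rw [← hn]; ring⟩

end Eigenvalues

/-! ### Arithmetic of the exceptional eigenvalues -/

/-- For `n ≥ 5` the number `2 cos (2π / n)` lies strictly between `0` and `2`, so it can only be an
integer if it is `1`. -/
theorem eq_six_of_two_mul_cos_eq_int {n : ℕ} (hn : 5 ≤ n) {m : ℤ}
    (h : 2 * Real.cos (2 * Real.pi / n) = m) : n = 6 := by
  have hn' : (5 : ℝ) ≤ n := by exact_mod_cast hn
  have hpi := Real.pi_pos
  have hx0 : 0 < 2 * Real.pi / n := by positivity
  have hx1 : 2 * Real.pi / n < Real.pi / 2 := by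
    rw [div_lt_div_iff₀ (by linarith) two_pos]
    nlinarith
  have h0 : 0 < Real.cos (2 * Real.pi / n) := Real.cos_pos_of_mem_Ioo ⟨by linarith, hx1⟩
  have h2 : Real.cos (2 * Real.pi / n) < 1 := by
    rw [← Real.cos_zero]
    exact Real.cos_lt_cos_of_nonneg_of_le_pi le_rfl (by linarith) hx0
  have hm : m = 1 := by
    have : (0 : ℝ) < m := by linarith
    have : (m : ℝ) < 2 := by linarith
    norm_cast at *
    omega
  have hc : Real.cos (2 * Real.pi / n) = Real.cos (Real.pi / 3) := by
    rw [Real.cos_pi_div_three]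
    rw [hm] at h
    push_cast at h
    linarith
  have := Real.injOn_cos ⟨hx0.le, by linarith⟩ ⟨by positivity, by linarith⟩ hc
  field_simp at this
  have h6 : (n : ℝ) = 6 := by linarith
  exact_mod_cast h6

theorem ne_int_sq_two (n : ℤ) : (2 : ℂ) ≠ (n : ℂ) ^ 2 := by
  intro h
  norm_cast at h
  have : n < 2 := by nlinarith
  have : -2 < n := by nlinarith
  interval_cases n <;> omega

theorem ne_int_sq_three (n : ℤ) : (3 : ℂ) ≠ (n : ℂ) ^ 2 := by
  intro h
  norm_cast at h
  have : n < 2 := by nlinarith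
  have : -2 < n := by nlinarith
  interval_cases n <;> omega

/-! ### Eigenvectors of a cyclic subgroup -/

section CyclicVectors

variable {G : Type*} [Group G]

/-- The vector `∑ ωⁱ gⁱ` of the group algebra, where `ω = exp (2πi / n)` and `n` is the order
of `g`: an eigenvector of left multiplication by `g`. -/
noncomputable def cyclicEigenvector (g : G) : MonoidAlgebra ℂ G :=
  ∑ i ∈ Finset.range (orderOf g),
    Complex.exp (2 * Real.pi * Complex.I / orderOf g) ^ i • .of ℂ G (g ^ i)

theorem of_mul_cyclicEigenvector [Finite G] (g : G) :
    .of ℂ G g * cyclicEigenvector g =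
      (Complex.exp (2 * Real.pi * Complex.I / orderOf g))⁻¹ • cyclicEigenvector g := by
  have hn : orderOf g ≠ 0 := (orderOf_pos g).ne'
  have hω := (Complex.isPrimitiveRoot_exp (orderOf g) hn).pow_eq_one
  unfold cyclicEigenvector
  set ω := Complex.exp (2 * Real.pi * Complex.I / orderOf g) with hωdef
  have h0 : ω ≠ 0 := Complex.exp_ne_zero _
  have hg := pow_orderOf_eq_one g
  obtain ⟨m, hm⟩ := Nat.exists_eq_succ_of_ne_zero hn
  rw [hm] at hω hg ⊢
  conv_lhs => rw [Finset.sum_range_succ]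
  conv_rhs => rw [Finset.sum_range_succ']
  rw [mul_add, smul_add, Finset.mul_sum,
    Finset.smul_sum]
  congr 1
  · refine Finset.sum_congr rfl fun i _ => ?_
    rw [mul_smul_comm, ← map_mul, ← pow_succ', smul_smul, pow_succ' ω i,
      inv_mul_cancel_left₀ h0]
  · rw [mul_smul_comm, ← map_mul, ← pow_succ', smul_smul, hg, pow_zero, pow_zero, mul_one]
    congr 1
    exact eq_inv_of_mul_eq_one_left (by rw [← pow_succ, hω])

theorem of_inv_mul_cyclicEigenvector [Finite G] (g : G) :
    .of ℂ G g⁻¹ * cyclicEigenvector g =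
      Complex.exp (2 * Real.pi * Complex.I / orderOf g) • cyclicEigenvector g := by
  have h := congrArg (fun u => Complex.exp (2 * Real.pi * Complex.I / orderOf g) •
    (.of ℂ G g⁻¹ * u)) (of_mul_cyclicEigenvector g)
  simp only [mul_smul_comm, smul_smul, mul_inv_cancel₀ (Complex.exp_ne_zero _), one_smul,
    ← mul_assoc, ← map_mul, inv_mul_cancel, map_one, one_mul] at h
  exact h.symm

theorem coeff_cyclicEigenvector_of_notMem {g h : G} (hh : h ∉ Subgroup.zpowers g) :
    (cyclicEigenvector g).coeff h = 0 := by
  classical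
  simp only [cyclicEigenvector, MonoidAlgebra.coeff_sum, Finsupp.finsetSum_apply,
    MonoidAlgebra.coeff_smul_apply, MonoidAlgebra.of_apply, MonoidAlgebra.coeff_single,
    Finsupp.single_apply]
  refine Finset.sum_eq_zero fun i _ => ?_
  rw [if_neg, smul_zero]
  rintro rfl
  exact hh (Subgroup.npow_mem_zpowers g i)

theorem coeff_one_cyclicEigenvector [Finite G] (g : G) : (cyclicEigenvector g).coeff 1 = 1 := by
  classical
  simp only [cyclicEigenvector, MonoidAlgebra.coeff_sum, Finsupp.finsetSum_apply,
    MonoidAlgebra.coeff_smul_apply, MonoidAlgebra.of_apply, MonoidAlgebra.coeff_single,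
    Finsupp.single_apply]
  rw [Finset.sum_eq_single 0]
  · simp
  · intro i hi h0
    rw [if_neg, smul_zero]
    exact pow_ne_one_of_lt_orderOf h0 (Finset.mem_range.mp hi)
  · intro h
    exact absurd (Finset.mem_range.mpr (orderOf_pos g)) h

theorem cyclicEigenvector_ne_zero [Finite G] (g : G) : cyclicEigenvector g ≠ 0 := by
  intro h
  have := coeff_one_cyclicEigenvector g
  rw [h] at this
  simp at this

theorem exp_add_exp_inv (n : ℕ) :
    Complex.exp (2 * Real.pi * Complex.I / n) + (Complex.exp (2 * Real.pi * Complex.I / n))⁻¹ =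
      ((2 * Real.cos (2 * Real.pi / n) : ℝ) : ℂ) := by
  rw [← Complex.exp_neg]
  push_cast
  rw [Complex.two_cos]
  congr 2 <;> ring

end CyclicVectors

/-! ### Products of two involutions -/

section InvolutionPairs

variable {G : Type*} [Group G]

theorem inv_triple_eq_of_mul_self {x y z : G} (hx : x * x = 1) (hy : y * y = 1) (hz : z * z = 1) :
    ({x, y, z} : Set G)⁻¹ = {x, y, z} := by
  rw [Set.inv_insert, Set.inv_insert, Set.inv_singleton, inv_eq_of_mul_eq_one_left hx,
    inv_eq_of_mul_eq_one_left hy, inv_eq_of_mul_eq_one_left hz]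

theorem inv_triple_eq_of_mul_eq_one {x y z : G} (hx : x * x = 1) (hyz : y * z = 1) :
    ({x, y, z} : Set G)⁻¹ = {x, y, z} := by
  rw [Set.inv_insert, Set.inv_insert, Set.inv_singleton, inv_eq_of_mul_eq_one_left hx,
    inv_eq_of_mul_eq_one_right hyz, inv_eq_of_mul_eq_one_left hyz, Set.pair_comm]

theorem mul_comm_iff_sq_eq_one {x y : G} (hx : x * x = 1) (hy : y * y = 1) :
    x * y = y * x ↔ (x * y) ^ 2 = 1 := by
  rw [pow_two, ← eq_inv_iff_mul_eq_one, mul_inv_rev, inv_eq_of_mul_eq_one_left hx,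
    inv_eq_of_mul_eq_one_left hy]

variable [Fintype G]

/-- The valency three connection set `{x, y, z}` with commuting `z`, on a vector `v` in the
`-1`-eigenspace of `z`: there `(x + y + z + 1)² = (x + y)² = 2 + xy + yx`. -/
theorem ClassA.exists_int_sq_of_commuting_involution (hG : ClassA 3 G) {x y z : G}
    (hx : x * x = 1) (hy : y * y = 1) (hz : z * z = 1) (hx1 : x ≠ 1) (hy1 : y ≠ 1) (hz1 : z ≠ 1)
    (hxy : x ≠ y) (hxz : x ≠ z) (hyz : y ≠ z) (hzx : z * x = x * z) (hzy : z * y = y * z)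
    {v : MonoidAlgebra ℂ G} (hv : v ≠ 0) (hzv : .of ℂ G z * v = -v) {e : ℂ}
    (he : .of ℂ G (x * y) * v + .of ℂ G (y * x) * v = e • v) : ∃ n : ℤ, 2 + e = (n : ℂ) ^ 2 := by
  refine hG.exists_int_sq hxy hxz hyz hx1 hy1 hz1 (inv_triple_eq_of_mul_self hx hy hz) hv
    (w := .of ℂ G x * v + .of ℂ G y * v) (-1) ?_ ?_
  · rw [add_mul, add_mul, hzv]
    push_cast
    module
  · have hzx' : .of ℂ G z * (.of ℂ G x * v) = -(.of ℂ G x * v) := by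
      rw [← mul_assoc, ← map_mul, hzx, map_mul, mul_assoc, hzv, mul_neg]
    have hzy' : .of ℂ G z * (.of ℂ G y * v) = -(.of ℂ G y * v) := by
      rw [← mul_assoc, ← map_mul, hzy, map_mul, mul_assoc, hzv, mul_neg]
    rw [mul_add, add_mul, add_mul, add_mul, add_mul, hzx', hzy', ← mul_assoc, ← mul_assoc,
      ← mul_assoc, ← mul_assoc, ← map_mul, ← map_mul, ← map_mul, ← map_mul, hx, hy, map_one,
      one_mul, add_smul, ← he]
    push_cast
    module

/-- The product `p` of two involutions of a group of class `𝒜₃` has order at most three. The orders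
4 and 6 need connection sets of their own, since the reflections `x`, `xp`, `xp⁻¹` have integral
eigenvalues `±1`, `±2` on the eigenvectors of `p` with primitive eigenvalue. -/
theorem ClassA.sq_eq_one_or_cube_eq_one (hG : ClassA 3 G) {x y : G} (hx : x * x = 1)
    (hy : y * y = 1) (hx1 : x ≠ 1) (hy1 : y ≠ 1) : (x * y) ^ 2 = 1 ∨ (x * y) ^ 3 = 1 := by
  by_contra! hcon
  obtain ⟨h2, h3⟩ := hcon
  have hinv : (x * y)⁻¹ = y * x := by
    rw [mul_inv_rev, inv_eq_of_mul_eq_one_left hx, inv_eq_of_mul_eq_one_left hy]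
  have hcomm : x * y ≠ y * x := fun h => h2 ((mul_comm_iff_sq_eq_one hx hy).mp h)
  obtain ⟨p, hp⟩ : ∃ p, p = x * y := ⟨_, rfl⟩
  have hpinv : p⁻¹ = y * x := by rw [hp, hinv]
  have hxp : x * p = y := by rw [hp, ← mul_assoc, hx, one_mul]
  have hpx : p * x = x * p⁻¹ := by rw [hp, hinv, mul_assoc]
  have hpy : p * y = y * p⁻¹ := by
    rw [hpinv, ← mul_assoc, hy, hp, mul_assoc, hy, one_mul, mul_one]
  have hxy : x ≠ y := by rintro rfl; exact hcomm rfl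
  rw [← hp] at h2 h3
  have hp1 : p ≠ 1 := by rintro rfl; simp at h2
  -- a power of `p` that is an involution commutes with `x` and `y`, and differs from both
  have hcentral : ∀ m : ℕ, p ^ m * p ^ m = 1 → p ^ m * x = x * p ^ m ∧ p ^ m * y = y * p ^ m ∧
      x ≠ p ^ m ∧ y ≠ p ^ m := by
    intro m hm
    have hpm : (p⁻¹) ^ m = p ^ m := by rw [inv_pow, inv_eq_of_mul_eq_one_left hm]
    have h1 : p ^ m * x = x * p ^ m := by
      have : SemiconjBy x p⁻¹ p := hpx.symm
      have h := (this.pow_right m).eq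
      rw [hpm] at h
      exact h.symm
    have h2 : p ^ m * y = y * p ^ m := by
      have : SemiconjBy y p⁻¹ p := hpy.symm
      have h := (this.pow_right m).eq
      rw [hpm] at h
      exact h.symm
    refine ⟨h1, h2, ?_, ?_⟩
    · rintro h
      exact hcomm (by rw [h, h2])
    · rintro h
      exact hcomm (by rw [h, h1])
  have hpos := orderOf_pos p
  have hn1 : orderOf p ≠ 1 := fun h => hp1 (orderOf_eq_one_iff.mp h)
  have hn2 : orderOf p ≠ 2 := fun h => h2 (h ▸ pow_orderOf_eq_one p)
  have hn3 : orderOf p ≠ 3 := fun h => h3 (h ▸ pow_orderOf_eq_one p)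
  have hyx : .of ℂ G (y * x) = MonoidAlgebra.of ℂ G p⁻¹ := by rw [hpinv]
  by_cases hn4 : orderOf p = 4
  · have hp4 : p ^ 4 = 1 := hn4 ▸ pow_orderOf_eq_one p
    have hinv3 : p⁻¹ = p ^ 3 := inv_eq_of_mul_eq_one_left (by rw [← pow_succ, hp4])
    obtain ⟨c1, c2, c3, c4⟩ := hcentral 2 (by rw [← pow_add, hp4])
    obtain ⟨n, hn⟩ := hG.exists_int_sq_of_commuting_involution hx hy (by rw [← pow_add, hp4])
      hx1 hy1 h2 hxy c3 c4 c1 c2 (v := 1 - .of ℂ G (p ^ 2)) (e := 0)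
      (by
        intro h
        have := congrArg (fun u => u.coeff 1) h
        simp [MonoidAlgebra.of_apply, h2] at this)
      (by
        rw [mul_sub, ← map_mul, ← pow_add, hp4, mul_one, map_one, neg_sub])
      (by
        rw [hyx, ← hp, hinv3, mul_sub, mul_sub, ← map_mul, ← map_mul, ← pow_succ', ← pow_add,
          zero_smul, show p ^ (3 + 2) = p by rw [pow_succ, hp4, one_mul]]
        simp)
    exact ne_int_sq_two n (by rw [← hn, add_zero])
  by_cases hn6 : orderOf p = 6
  · have hp6 : p ^ 6 = 1 := hn6 ▸ pow_orderOf_eq_one p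
    have hp4 : p ^ 4 ≠ 1 := pow_ne_one_of_lt_orderOf (by norm_num) (by omega)
    have hinv5 : p⁻¹ = p ^ 5 := inv_eq_of_mul_eq_one_left (by rw [← pow_succ, hp6])
    obtain ⟨c1, c2, c3, c4⟩ := hcentral 3 (by rw [← pow_add, hp6])
    -- in `ℂ[p]` this vector is killed by `p³ + 1` and by `p² - p + 1`
    obtain ⟨n, hn⟩ := hG.exists_int_sq_of_commuting_involution hx hy (by rw [← pow_add, hp6])
      hx1 hy1 h3 hxy c3 c4 c1 c2
      (v := 1 + .of ℂ G p - .of ℂ G (p ^ 3) - .of ℂ G (p ^ 4)) (e := 1)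
      (by
        intro h
        have := congrArg (fun u => u.coeff 1) h
        simp [MonoidAlgebra.of_apply, hp1, h3, hp4] at this)
      (by
        rw [mul_sub, mul_sub, mul_add, ← map_mul, ← map_mul, ← map_mul, ← pow_succ, ← pow_add,
          ← pow_add, hp6, mul_one, map_one, show p ^ (3 + 4) = p by rw [pow_succ, hp6, one_mul]]
        abel)
      (by
        rw [hyx, ← hp, hinv5]
        simp only [mul_sub, mul_add, ← map_mul, ← pow_succ, ← pow_succ', ← pow_add, mul_one]
        rw [show p ^ (5 + 3) = p ^ 2 by rw [show 5 + 3 = 6 + 2 from rfl, pow_add, hp6, one_mul],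
          show p ^ (5 + 4) = p ^ 3 by rw [show 5 + 4 = 6 + 3 from rfl, pow_add, hp6, one_mul],
          show p * p = p ^ 2 from (pow_two p).symm, hp6, map_one, one_smul]
        simp only [show 3 + 1 = 4 from rfl, show 4 + 1 = 5 from rfl]
        abel)
    exact ne_int_sq_three n (by rw [← hn]; norm_num)
  have hn5 : 5 ≤ orderOf p := by omega
  -- left multiplication by `1 + p + p⁻¹` scales both `V` and `x V` by `1 + ω + ω⁻¹`
  obtain ⟨V, hV⟩ : ∃ V, V = cyclicEigenvector p := ⟨_, rfl⟩
  have e1 := of_mul_cyclicEigenvector p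
  have e2 := of_inv_mul_cyclicEigenvector p
  have e3 := exp_add_exp_inv (orderOf p)
  have hV0 := cyclicEigenvector_ne_zero p
  set ω := Complex.exp (2 * Real.pi * Complex.I / orderOf p)
  rw [← hV] at e1 e2 hV0
  have hxinv : x⁻¹ = x := inv_eq_of_mul_eq_one_left hx
  have hpinvx : p⁻¹ * x = x * p := by
    rw [inv_mul_eq_iff_eq_mul, ← mul_assoc, hpx, mul_assoc, inv_mul_cancel, mul_one]
  have hs1 : x * p⁻¹ * (x * p⁻¹) = 1 := by
    rw [mul_assoc, ← mul_assoc p⁻¹, hpinvx, mul_assoc x p, mul_inv_cancel, mul_one, hx]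
  have hs0 : x * p * (x * p) = 1 := by rw [hxp, hy]
  obtain ⟨n, hn⟩ := hG.exists_int_sq (a := x) (b := x * p) (c := x * p⁻¹)
    (by simpa using hp1) (by simpa using hp1)
    (by
      rw [Ne, mul_right_inj, eq_inv_iff_mul_eq_one, ← pow_two]
      exact h2)
    hx1 (by rwa [hxp])
    (by
      rw [← hpx, hp, Ne, mul_eq_one_iff_eq_inv, hxinv, mul_eq_left]
      exact hy1)
    (inv_triple_eq_of_mul_self hx hs0 hs1) hV0 (w := (1 + ω + ω⁻¹) • (.of ℂ G x * V))
    (d := (1 + ω + ω⁻¹) ^ 2) 0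
    (by
      rw [add_mul, add_mul, map_mul, map_mul, mul_assoc, mul_assoc, e1, e2, mul_smul_comm,
        mul_smul_comm]
      push_cast
      module)
    (by
      have q1 : .of ℂ G (x * p) * (.of ℂ G x * V) = ω • V := by
        rw [← mul_assoc, ← map_mul, mul_assoc, hpx, ← mul_assoc, hx, one_mul, e2]
      have q2 : .of ℂ G (x * p⁻¹) * (.of ℂ G x * V) = ω⁻¹ • V := by
        rw [← mul_assoc, ← map_mul, mul_assoc, hpinvx, ← mul_assoc, hx, one_mul, e1]
      have q3 : .of ℂ G x * (.of ℂ G x * V) = V := by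
        rw [← mul_assoc, ← map_mul, hx, map_one, one_mul]
      rw [mul_smul_comm, add_mul, add_mul, q1, q2, q3]
      push_cast
      module)
  rw [add_assoc, e3] at hn
  have hsq : ((1 + 2 * Real.cos (2 * Real.pi / orderOf p)) : ℝ) ^ 2 = (n : ℝ) ^ 2 := by
    exact_mod_cast hn
  rcases sq_eq_sq_iff_eq_or_eq_neg.mp hsq with h | h
  · exact hn6 (eq_six_of_two_mul_cos_eq_int hn5 (m := n - 1) (by push_cast; linarith))
  · exact hn6 (eq_six_of_two_mul_cos_eq_int hn5 (m := -n - 1) (by push_cast; linarith))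

end InvolutionPairs

/-! ### Ring identities producing the eigenvalues `±√3` -/

section RingIdentities

variable {R : Type*} [Ring R]

/-- On the image of `(1 - s)(1 - ab)`, where `1 + s + s² = 0` and `1 + ab + (ab)² = 0`, the element
`a + bs + bs²` acts as `a - b`, whose square is `2 - ab - ba = 3`. -/
theorem sq_mul_eq_three_of_commute {a b s : R} (ha : a * a = 1) (hb : b * b = 1)
    (hab : (a * b) * (a * b) = b * a) (has : s * a = a * s) (hbs : s * b = b * s)
    (hs : s * (s * s) = 1) :
    (a + b * s + b * (s * s)) * ((a + b * s + b * (s * s)) * ((1 - s) * (1 - a * b))) =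
      3 * ((1 - s) * (1 - a * b)) := by
  have hT : (a + b * s + b * (s * s)) * (1 - s) = (a - b) * (1 - s) := by
    have : (a + b * s + b * (s * s)) * (1 - s) = (a - b) * (1 - s) + b * (1 - s * (s * s)) := by
      noncomm_ring
    rw [this, hs, sub_self, mul_zero, add_zero]
  have hc : (1 - s) * (a - b) = (a - b) * (1 - s) := by
    have : (1 - s) * (a - b) = (a - b) - (s * a - s * b) := by noncomm_ring
    rw [this, has, hbs]
    noncomm_ring
  have hsq : (a - b) * ((a - b) * (1 - a * b)) = 3 * (1 - a * b) := by
    have : (a - b) * ((a - b) * (1 - a * b)) = (a * a + b * b - a * b - b * a)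
        - ((a * a) * (a * b) + b * b * (a * b) - (a * b) * (a * b) - b * (a * a) * b) := by
      noncomm_ring
    rw [this, ha, hb, hab, mul_one, hb]
    noncomm_ring
  have hT' : ∀ u, (a + b * s + b * (s * s)) * ((1 - s) * u) = (1 - s) * ((a - b) * u) := by
    intro u
    rw [← mul_assoc, hT, ← hc, mul_assoc]
  rw [hT', hT', hsq]
  noncomm_ring

/-- For involutions `a`, `b`, `c` with `r = ab` and `q = ac` of order three, `hsq` reads
`(a + b + c)² = 3 + r + r⁻¹ + q + q⁻¹ + r⁻¹q + q⁻¹r`. If `r` and `q` commute, this is `3` on the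
image of `(1 + r + r²)(1 - q)`, where `r = 1` and `1 + q + q² = 0`. -/
theorem sq_mul_eq_three_of_commuting_products {a b c r q : R}
    (hsq : (a + b + c) * (a + b + c) = 3 + r + r * r + q + q * q + r * r * q + q * q * r)
    (hr : r * (r * r) = 1) (hq : q * (q * q) = 1) (hrq : r * q = q * r) :
    (a + b + c) * ((a + b + c) * ((1 + r + r * r) * (1 - q))) =
      3 * ((1 + r + r * r) * (1 - q)) := by
  have hrN : r * (1 + r + r * r) = 1 + r + r * r := by
    rw [mul_add, mul_add, hr]
    noncomm_ring
  have hqN : q * (1 + r + r * r) = (1 + r + r * r) * q := by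
    have : q * (1 + r + r * r) = q + q * r + q * r * r := by noncomm_ring
    rw [this, ← hrq, mul_assoc r, ← hrq]
    noncomm_ring
  obtain ⟨N, hN⟩ : ∃ N, N = 1 + r + r * r := ⟨_, rfl⟩
  rw [← hN] at hrN hqN ⊢
  have h1 : r * (N * (1 - q)) = N * (1 - q) := by rw [← mul_assoc, hrN]
  have h2 : q * (N * (1 - q)) = N * (q - q * q) := by
    rw [← mul_assoc, hqN]
    noncomm_ring
  have h3 : q * (N * (q - q * q)) = N * (q * q - 1) := by
    rw [← mul_assoc, hqN, mul_assoc, mul_sub, hq]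
  have h4 : r * (N * (q - q * q)) = N * (q - q * q) := by rw [← mul_assoc, hrN]
  rw [← mul_assoc, hsq]
  simp only [add_mul, mul_assoc, h1, h2, h3, h4]
  noncomm_ring

end RingIdentities

/-! ### Relations between three involutions -/

section InvolutionTriples

variable {G : Type*} [Group G]

/-- The relations are the Coxeter relations of `S₄`, where `xzy` is a 4-cycle; the word is rewritten
with these relations and their consequence `zyxz = yzyx`. -/
theorem fourth_pow_eq_one_of_braid {x y z : G} (hx : x * x = 1) (hy : y * y = 1) (hz : z * z = 1)
    (hxz : z * x = x * z) (hxy : y * x * y = x * y * x) (hyz : z * y * z = y * z * y) :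
    (x * z * y) ^ 4 = 1 := by
  have tail : ∀ {u w : G}, u = w → ∀ t, u * t = w * t := by rintro u _ rfl t; rfl
  have h8 : z * y * x * z = y * z * y * x := by rw [mul_assoc _ x, ← hxz, ← mul_assoc, hyz]
  have h1' := tail hx; have h2' := tail hy; have h3' := tail hz; have h4' := tail hxz
  have h5' := tail hxy; have h6' := tail hyz; have h8' := tail h8
  simp only [mul_assoc, one_mul] at *
  simp only [pow_succ, pow_zero, one_mul, mul_assoc, *]

theorem braid_of_cube_eq_one {x y : G} (hx : x * x = 1) (hy : y * y = 1) (h : (x * y) ^ 3 = 1) :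
    y * x * y = x * y * x := by
  have h1 : x * y * x * (y * x * y) = 1 := by
    rw [← h]
    simp [pow_succ, mul_assoc]
  have h2 : y * x * y * (y * x * y) = 1 := by
    rw [mul_assoc, ← mul_assoc y (y * x), ← mul_assoc y y, hy, one_mul, mul_assoc,
      ← mul_assoc x, hx, one_mul, hy]
  exact mul_right_cancel (h2.trans h1.symm)

/-- In a group of exponent three conjugate elements commute; only the cubes needed are assumed. With
`rᵢ = qⁱrq⁻ⁱ` the hypotheses give `r₀r₁r₂ = 1` and `r₀⁻¹r₁⁻¹r₂⁻¹ = 1`; eliminate `r₂`. -/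
theorem commute_conj_of_cubes {r q : G} (hq : q ^ 3 = 1) (h1 : (r * q) ^ 3 = 1)
    (h2 : (r⁻¹ * q) ^ 3 = 1) : Commute r (q * r * q⁻¹) := by
  have e1 : r * (q * r * q⁻¹) * (q ^ 2 * r * (q ^ 2)⁻¹) = 1 := by
    have : r * (q * r * q⁻¹) * (q ^ 2 * r * (q ^ 2)⁻¹) = (r * q) ^ 3 * (q ^ 3)⁻¹ := by
      simp only [pow_succ (r * q), pow_zero]
      group
    rw [this, h1, hq, inv_one, mul_one]
  have e2 : r⁻¹ * (q * r⁻¹ * q⁻¹) * (q ^ 2 * r⁻¹ * (q ^ 2)⁻¹) = 1 := by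
    have : r⁻¹ * (q * r⁻¹ * q⁻¹) * (q ^ 2 * r⁻¹ * (q ^ 2)⁻¹) = (r⁻¹ * q) ^ 3 * (q ^ 3)⁻¹ := by
      simp only [pow_succ (r⁻¹ * q), pow_zero]
      group
    rw [this, h2, hq, inv_one, mul_one]
  have e3 : q ^ 2 * r * (q ^ 2)⁻¹ = (r * (q * r * q⁻¹))⁻¹ := eq_inv_of_mul_eq_one_right e1
  have e4 : q ^ 2 * r * (q ^ 2)⁻¹ = r⁻¹ * (q * r * q⁻¹)⁻¹ := by
    rw [mul_eq_one_iff_eq_inv] at e2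
    rw [show (q * r * q⁻¹)⁻¹ = q * r⁻¹ * q⁻¹ by group, e2]
    group
  rw [e3, mul_inv_rev] at e4
  have e5 : Commute r⁻¹ (q * r * q⁻¹)⁻¹ := e4.symm
  exact Commute.inv_inv_iff.mp e5

end InvolutionTriples

/-! ### Copies of `S₃` in groups of class `𝒜₃` -/

section SymmetricSubgroups

variable {G : Type*} [Group G] [Fintype G]

theorem ClassA.cube_eq_one_of_not_comm (hG : ClassA 3 G) {x y : G} (hx : x * x = 1)
    (hy : y * y = 1) (hxy : x * y ≠ y * x) : (x * y) ^ 3 = 1 := by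
  refine (hG.sq_eq_one_or_cube_eq_one hx hy ?_ ?_).resolve_left
    fun h => hxy ((mul_comm_iff_sq_eq_one hx hy).mpr h)
  · rintro rfl
    simp at hxy
  · rintro rfl
    simp at hxy

/-- Two noncommuting involutions `x`, `y` generate a copy of `S₃`, and an involution `z` commuting
with both would make `(zx)y` an element of order six. -/
theorem ClassA.eq_one_of_mul_self_of_comm (hG : ClassA 3 G) {x y z : G} (hx : x * x = 1)
    (hy : y * y = 1) (hxy : x * y ≠ y * x) (hz : z * z = 1) (hzx : z * x = x * z)
    (hzy : z * y = y * z) : z = 1 := by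
  by_contra hz1
  have h3 := hG.cube_eq_one_of_not_comm hx hy hxy
  have hc : Commute z (x * y) := Commute.mul_right hzx hzy
  have hy1 : y ≠ 1 := by rintro rfl; simp at hxy
  have hzx1 : z * x ≠ 1 := by
    intro h
    rw [mul_eq_one_iff_eq_inv, inv_eq_of_mul_eq_one_left hx] at h
    exact hxy (h ▸ hzy)
  have hzxx : z * x * (z * x) = 1 := by
    rw [mul_assoc, ← mul_assoc x, ← hzx, mul_assoc z x x, hx, mul_one, hz]
  rcases hG.sq_eq_one_or_cube_eq_one hzxx hy hzx1 hy1 with h | h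
  · rw [mul_assoc, hc.mul_pow, pow_two z, hz, one_mul] at h
    exact hxy ((mul_comm_iff_sq_eq_one hx hy).mpr h)
  · rw [mul_assoc, hc.mul_pow, h3, pow_succ, pow_two z, hz, one_mul, mul_one] at h
    exact hz1 h

/-- A subgroup `S₃` has trivial centralizer. -/
theorem ClassA.eq_one_of_comm (hG : ClassA 3 G) {x y c : G} (hx : x * x = 1)
    (hy : y * y = 1) (hxy : x * y ≠ y * x) (hcx : c * x = x * c) (hcy : c * y = y * c) :
    c = 1 := by
  by_contra hc1
  have h3 := hG.cube_eq_one_of_not_comm hx hy hxy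
  have hx1 : x ≠ 1 := by rintro rfl; simp at hxy
  have hy1 : y ≠ 1 := by rintro rfl; simp at hxy
  have hpos := orderOf_pos c
  have hn1 : orderOf c ≠ 1 := fun h => hc1 (orderOf_eq_one_iff.mp h)
  -- for even order an involution in `⟨c⟩` centralizes `x` and `y`
  rcases Nat.even_or_odd (orderOf c) with ⟨m, hm⟩ | hodd
  · have hcm : c ^ m = 1 := by
      refine hG.eq_one_of_mul_self_of_comm hx hy hxy ?_ (Commute.pow_left hcx m)
        (Commute.pow_left hcy m)
      rw [← pow_add, ← hm, pow_orderOf_eq_one]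
    exact pow_ne_one_of_lt_orderOf (by omega) (by omega) hcm
  have hxz : x ∉ Subgroup.zpowers c := by
    rintro ⟨k, rfl⟩
    exact hxy (Commute.zpow_left hcy k)
  have hcc : c ≠ c⁻¹ := by
    intro h
    rw [eq_inv_iff_mul_eq_one, ← pow_two] at h
    have := Nat.le_of_dvd two_pos (orderOf_dvd_of_pow_eq_one h)
    obtain ⟨k, hk⟩ := hodd
    omega
  by_cases hn3 : orderOf c = 3
  · have hc3 : c * (c * c) = 1 := by
      have : c ^ orderOf c = 1 := pow_orderOf_eq_one c
      rwa [hn3, pow_succ', pow_two] at this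
    have hcinv : c⁻¹ = c * c := inv_eq_of_mul_eq_one_right hc3
    have hxc : x ≠ y * c ∧ x ≠ y * c⁻¹ := by
      constructor
      · intro h
        exact hxy (by rw [h, mul_assoc, hcy])
      · intro h
        have hcy' : c⁻¹ * y = y * c⁻¹ := Commute.inv_left hcy
        exact hxy (by rw [h, mul_assoc, hcy'])
    have hyc : y * c ≠ 1 ∧ y * c⁻¹ ≠ 1 := by
      constructor
      · intro h
        have : y = c⁻¹ := mul_eq_one_iff_eq_inv.mp h
        have hcx' : c⁻¹ * x = x * c⁻¹ := Commute.inv_left hcx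
        exact hxy (by rw [this, hcx'])
      · intro h
        have : y = c := by simpa using mul_eq_one_iff_eq_inv.mp h
        exact hxy (by rw [this, hcx])
    have hprod : y * c * (y * c⁻¹) = 1 := by
      rw [mul_assoc, ← mul_assoc c, hcy, mul_assoc y c, mul_inv_cancel, mul_one, hy]
    have hp2 : x * y * (x * y) = y * x := by
      have : y * x = (x * y)⁻¹ := by
        rw [mul_inv_rev, inv_eq_of_mul_eq_one_left hx, inv_eq_of_mul_eq_one_left hy]
      rw [this, eq_inv_iff_mul_eq_one, ← pow_two, ← pow_succ, h3]
    have key := sq_mul_eq_three_of_commute (R := MonoidAlgebra ℂ G) (a := .of ℂ G x)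
      (b := .of ℂ G y) (s := .of ℂ G c) (by rw [← map_mul, hx, map_one])
      (by rw [← map_mul, hy, map_one]) (by simp only [← map_mul, hp2])
      (by simp only [← map_mul, hcx]) (by simp only [← map_mul, hcy])
      (by simp only [← map_mul, hc3, map_one])
    simp only [← map_mul, ← hcinv] at key
    obtain ⟨n, hn⟩ := hG.exists_int_sq hxc.1 hxc.2 (by simpa using hcc) hx1 hyc.1 hyc.2
      (inv_triple_eq_of_mul_eq_one hx hprod) (d := 3)
      (v := (1 - .of ℂ G c) * (1 - .of ℂ G (x * y)))
      (by
        have hp1 : x * y ≠ 1 := by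
          intro h
          exact hxy (by rw [h, eq_comm, ← mul_eq_one_comm, h])
        have hcp : c * (x * y) ≠ 1 := by
          intro h
          rw [← mul_assoc, hcx, mul_assoc, mul_eq_one_iff_inv_eq, inv_eq_of_mul_eq_one_left hx] at h
          exact hxy (by rw [h, mul_assoc, hy, mul_one, ← mul_assoc, ← hcy, mul_assoc, hy, mul_one])
        intro h
        have := congrArg (fun u => u.coeff 1) h
        simp only [sub_mul, mul_sub, one_mul, mul_one, ← map_mul] at this
        simp [MonoidAlgebra.of_apply, hc1, hp1, hcp] at this) 0
      (by rw [Int.cast_zero, zero_smul, zero_add])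
      (by
        rw [key, Int.cast_zero, zero_smul, zero_add, ofNat_smul_eq_nsmul, nsmul_eq_mul,
          Nat.cast_ofNat])
    exact ne_int_sq_three n hn
  have hn5 : 5 ≤ orderOf c := by
    obtain ⟨k, hk⟩ := hodd
    omega
  have e1 := of_mul_cyclicEigenvector c
  have e2 := of_inv_mul_cyclicEigenvector c
  have e3 := exp_add_exp_inv (orderOf c)
  have e4 := coeff_one_cyclicEigenvector c
  have e5 := coeff_cyclicEigenvector_of_notMem hxz
  set ω := Complex.exp (2 * Real.pi * Complex.I / orderOf c)
  set V := cyclicEigenvector c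
  have hcx' : c⁻¹ * x = x * c⁻¹ := Commute.inv_left hcx
  obtain ⟨n, hn⟩ := hG.exists_int_of_mul_eq_smul (a := x) (b := c) (c := c⁻¹)
    (by rintro rfl; exact hxz (Subgroup.mem_zpowers x))
    (by
      intro h
      exact hxz (h ▸ inv_mem (Subgroup.mem_zpowers c)))
    hcc hx1 hc1 (inv_ne_one.mpr hc1)
    (inv_triple_eq_of_mul_eq_one hx (mul_inv_cancel c)) (v := V + .of ℂ G x * V)
    (l := 1 + (ω + ω⁻¹))
    (by
      intro h
      have := congrArg (fun u => u.coeff 1) h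
      simp only [MonoidAlgebra.coeff_add, Finsupp.add_apply, MonoidAlgebra.of_apply,
        MonoidAlgebra.coeff_single_mul_apply, one_mul, mul_one, inv_eq_of_mul_eq_one_left hx, e4,
        e5] at this
      simp at this)
    (by
      have q1 : .of ℂ G c * (.of ℂ G x * V) = ω⁻¹ • (.of ℂ G x * V) := by
        rw [← mul_assoc, ← map_mul, hcx, map_mul, mul_assoc, e1, mul_smul_comm]
      have q2 : .of ℂ G c⁻¹ * (.of ℂ G x * V) = ω • (.of ℂ G x * V) := by
        rw [← mul_assoc, ← map_mul, hcx', map_mul, mul_assoc, e2, mul_smul_comm]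
      have q3 : .of ℂ G x * (.of ℂ G x * V) = V := by
        rw [← mul_assoc, ← map_mul, hx, map_one, one_mul]
      simp only [mul_add, add_mul, e1, e2, q1, q2, q3]
      module)
  rw [e3] at hn
  have hn' : 2 * Real.cos (2 * Real.pi / orderOf c) = ((n - 1 : ℤ) : ℝ) := by
    have : (1 + 2 * Real.cos (2 * Real.pi / orderOf c) : ℝ) = (n : ℝ) := by exact_mod_cast hn
    push_cast
    linarith
  have h6 := eq_six_of_two_mul_cos_eq_int hn5 hn'
  rw [h6] at hodd
  exact absurd hodd (by decide)

/-- The element `xzy`, a product of the involutions `xz` and `y`, satisfies `(xzy)⁴ = 1`, but its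
square or its cube is trivial. Either way the configuration collapses. -/
theorem ClassA.false_of_comm_of_not_comm (hG : ClassA 3 G) {x y z : G} (hx : x * x = 1)
    (hy : y * y = 1) (hz : z * z = 1) (hxy : x * y ≠ y * x) (hzx : z * x = x * z)
    (hzy : z * y ≠ y * z) (hne : z ≠ x) : False := by
  have b1 := braid_of_cube_eq_one hx hy (hG.cube_eq_one_of_not_comm hx hy hxy)
  have b2 := braid_of_cube_eq_one hy hz (hG.cube_eq_one_of_not_comm hy hz hzy.symm)
  have h4 := fourth_pow_eq_one_of_braid hx hy hz hzx b1 b2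
  have hy1 : y ≠ 1 := by rintro rfl; simp at hxy
  have hxzxz : x * z * (x * z) = 1 := by
    rw [mul_assoc, ← mul_assoc z, hzx, mul_assoc x z z, hz, mul_one, hx]
  have hxz1 : x * z ≠ 1 := by
    intro h
    rw [mul_eq_one_iff_inv_eq, inv_eq_of_mul_eq_one_left hx] at h
    exact hne h.symm
  rcases hG.sq_eq_one_or_cube_eq_one hxzxz hy hxz1 hy1 with h | h
  · -- `y` commutes with `xz`, so conjugating by `y` identifies `xyx` and `zyz`
    have hc := (mul_comm_iff_sq_eq_one hxzxz hy).mpr h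
    have : z * y * z = x * y * x := by
      calc z * y * z = x * x * (z * y * z) := by rw [hx, one_mul]
        _ = x * (x * z * y) * z := by simp only [mul_assoc]
        _ = x * y * x * (z * z) := by rw [hc]; simp only [mul_assoc]
        _ = x * y * x := by rw [hz, mul_one]
    rw [b2, ← b1] at this
    exact hne (mul_left_cancel (mul_right_cancel this))
  · rw [pow_succ, h, one_mul] at h4
    have : y = x * z := by
      rw [mul_eq_one_iff_inv_eq, inv_eq_of_mul_eq_one_left hxzxz] at h4
      exact h4.symm
    apply hxy
    rw [this, mul_assoc x z x, hzx]

/-- Every involution lies in the copy of `S₃` generated by two noncommuting involutions `x`, `y`. -/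
theorem ClassA.mem_of_mul_self (hG : ClassA 3 G) {x y z : G} (hx : x * x = 1)
    (hy : y * y = 1) (hz : z * z = 1) (hxy : x * y ≠ y * x) (hz1 : z ≠ 1) :
    z = x ∨ z = y ∨ z = x * y * x := by
  by_contra! hcon
  obtain ⟨hzx, hzy, hzw⟩ := hcon
  have hx1 : x ≠ 1 := by rintro rfl; simp at hxy
  have hy1 : y ≠ 1 := by rintro rfl; simp at hxy
  have hw : x * y * x * (x * y * x) = 1 := by
    rw [mul_assoc, mul_assoc x y x, ← mul_assoc x x, hx, one_mul, mul_assoc, ← mul_assoc y, hy,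
      one_mul, hx]
  by_cases czx : z * x = x * z
  · by_cases czy : z * y = y * z
    · exact hz1 (hG.eq_one_of_comm hx hy hxy czx czy)
    · exact hG.false_of_comm_of_not_comm hx hy hz hxy czx czy hzx
  by_cases czy : z * y = y * z
  · exact hG.false_of_comm_of_not_comm hy hx hz hxy.symm czy czx hzy
  by_cases czw : z * (x * y * x) = x * y * x * z
  · refine hG.false_of_comm_of_not_comm hw hx hz ?_ czw czx hzw
    rw [mul_assoc (x * y), hx, mul_one, ← mul_assoc, ← mul_assoc, hx, one_mul]
    exact hxy
  -- `r` and `q` generate a quotient of the extraspecial group of order 27 and exponent 3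
  obtain ⟨r, hr⟩ : ∃ r, r = x * y := ⟨_, rfl⟩
  obtain ⟨q, hq⟩ : ∃ q, q = x * z := ⟨_, rfl⟩
  have ex : x⁻¹ = x := inv_eq_of_mul_eq_one_left hx
  have ey : y⁻¹ = y := inv_eq_of_mul_eq_one_left hy
  have ez : z⁻¹ = z := inv_eq_of_mul_eq_one_left hz
  have hxr : x * r = y := by rw [hr, ← mul_assoc, hx, one_mul]
  have hxq : x * q = z := by rw [hq, ← mul_assoc, hx, one_mul]
  have hrinv : r⁻¹ = y * x := by rw [hr, mul_inv_rev, ex, ey]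
  have hqinv : q⁻¹ = z * x := by rw [hq, mul_inv_rev, ex, ez]
  have hr3 : r ^ 3 = 1 := hr ▸ hG.cube_eq_one_of_not_comm hx hy hxy
  have hq3 : q ^ 3 = 1 := hq ▸ hG.cube_eq_one_of_not_comm hx hz (Ne.symm czx)
  have hyz : y * z = r⁻¹ * q := by
    rw [hrinv, hq, mul_assoc, ← mul_assoc x, hx, one_mul]
  have hzy' : z * y = q⁻¹ * r := by
    rw [hqinv, hr, mul_assoc, ← mul_assoc x, hx, one_mul]
  have h1 : (r * q) ^ 3 = 1 := by
    have := hG.cube_eq_one_of_not_comm hw hz (Ne.symm czw)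
    rwa [hr, hq, ← mul_assoc]
  have h2 : (r⁻¹ * q) ^ 3 = 1 := by
    rw [← hyz]
    exact hG.cube_eq_one_of_not_comm hy hz (Ne.symm czy)
  have h3 : (q * r) ^ 3 = 1 := by
    have : (q * r) ^ 3 = r⁻¹ * (r * q) ^ 3 * r := by
      simp only [pow_succ, pow_zero]
      group
    rw [this, h1]
    simp
  have h4 : (q⁻¹ * r) ^ 3 = 1 := by
    rw [← hzy']
    exact hG.cube_eq_one_of_not_comm hz hy czy
  have hrq : r * q = q * r := by
    -- the commutator of `r` and `q` is central in `⟨x, y, z⟩`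
    have c1 : Commute r (r * (q * r * q⁻¹)⁻¹) :=
      (Commute.refl r).mul_right (commute_conj_of_cubes hq3 h1 h2).inv_right
    have c2 : Commute q (r * q * r⁻¹ * q⁻¹) :=
      (commute_conj_of_cubes hr3 h3 h4).mul_right (Commute.refl q).inv_right
    have hk : r * (q * r * q⁻¹)⁻¹ = r * q * r⁻¹ * q⁻¹ := by group
    rw [hk] at c1
    have c3 : r * q * r⁻¹ * q⁻¹ * x = x * (r * q * r⁻¹ * q⁻¹) := by
      have i1 : x * r * x = r⁻¹ := by rw [hxr, hrinv]
      have i2 : x * q * x = q⁻¹ := by rw [hxq, hqinv]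
      have hconj : x * (r * q * r⁻¹ * q⁻¹) * x⁻¹ = r⁻¹ * q⁻¹ * r * q := by
        have : x * (r * q * r⁻¹ * q⁻¹) * x⁻¹ =
            (x * r * x⁻¹) * (x * q * x⁻¹) * (x * r * x⁻¹)⁻¹ * (x * q * x⁻¹)⁻¹ := by group
        rw [this, ex, i1, i2, inv_inv, inv_inv]
      have hk' : r⁻¹ * q⁻¹ * r * q = r * q * r⁻¹ * q⁻¹ := by
        calc r⁻¹ * q⁻¹ * r * q = (q * r)⁻¹ * (r * q * r⁻¹ * q⁻¹) * (q * r) := by group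
          _ = r * q * r⁻¹ * q⁻¹ := by
            rw [mul_assoc, ← (c2.mul_left c1).eq, inv_mul_cancel_left]
      rw [hk', mul_inv_eq_iff_eq_mul] at hconj
      exact hconj.symm
    have c4 : r * q * r⁻¹ * q⁻¹ * y = y * (r * q * r⁻¹ * q⁻¹) := by
      rw [← hxr]
      exact Commute.mul_right c3 c1.symm
    have hk1 := hG.eq_one_of_comm hx hy hxy c3 c4
    rw [mul_inv_eq_one, mul_inv_eq_iff_eq_mul] at hk1
    exact hk1
  have hr3' : r * (r * r) = 1 := by rw [← hr3, pow_succ', pow_two]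
  have hq3' : q * (q * q) = 1 := by rw [← hq3, pow_succ', pow_two]
  have hrinv' : r⁻¹ = r * r := inv_eq_of_mul_eq_one_right hr3'
  have hqinv' : q⁻¹ = q * q := inv_eq_of_mul_eq_one_right hq3'
  have key := sq_mul_eq_three_of_commuting_products (R := MonoidAlgebra ℂ G) (a := .of ℂ G x)
    (b := .of ℂ G y) (c := .of ℂ G z) (r := .of ℂ G r) (q := .of ℂ G q)
    (by
      simp only [add_mul, mul_add, ← map_mul, hx, hy, hz, map_one, ← hr, ← hq, hyz, hzy', ← hrinv,
        ← hqinv, hrinv', hqinv', mul_assoc]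
      rw [show (3 : MonoidAlgebra ℂ G) = 1 + 1 + 1 by norm_num]
      abel)
    (by simp only [← map_mul, hr3', map_one]) (by simp only [← map_mul, hq3', map_one])
    (by simp only [← map_mul, hrq])
  obtain ⟨n, hn⟩ := hG.exists_int_sq (Ne.symm fun h => hxy (by rw [h])) (Ne.symm hzx)
    (Ne.symm hzy) hx1 hy1 hz1 (inv_triple_eq_of_mul_self hx hy hz) (d := 3)
    (v := (1 + .of ℂ G r + .of ℂ G r * .of ℂ G r) * (1 - .of ℂ G q))
    (by
      have g1 : r ≠ 1 := by
        rw [hr, Ne, mul_eq_one_iff_inv_eq, ex]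
        exact fun h => hxy (by rw [h])
      have g2 : r * r ≠ 1 := by
        rwa [← hrinv', inv_ne_one]
      have g3 : q ≠ 1 := by
        rw [hq, Ne, mul_eq_one_iff_inv_eq, ex]
        exact Ne.symm hzx
      have g4 : r * q ≠ 1 := by
        rw [hr, hq, ← mul_assoc, Ne, mul_eq_one_iff_eq_inv, ez]
        exact Ne.symm hzw
      have g5 : r * (r * q) ≠ 1 := by
        rw [← mul_assoc, ← hrinv', ← hyz, Ne, mul_eq_one_iff_eq_inv, ez]
        exact Ne.symm hzy
      intro h
      have := congrArg (fun u => u.coeff 1) h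
      simp only [mul_sub, add_mul, mul_one, one_mul, ← map_mul, mul_assoc] at this
      simp [MonoidAlgebra.of_apply, g1, g2, g3, g4, g5] at this) 0
    (by rw [Int.cast_zero, zero_smul, zero_add])
    (by
      rw [key, Int.cast_zero, zero_smul, zero_add, ofNat_smul_eq_nsmul, nsmul_eq_mul,
        Nat.cast_ofNat])
  exact ne_int_sq_three n hn

/-- An element `g` permutes the three involutions `x`, `y`, `xyx` by conjugation, as some `h` in
the group they generate does, and then `h⁻¹ * g` centralizes that group. -/
theorem ClassA.closure_eq_top (hG : ClassA 3 G) {x y : G} (hx : x * x = 1)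
    (hy : y * y = 1) (hxy : x * y ≠ y * x) : Subgroup.closure {x, y} = ⊤ := by
  have hxH : x ∈ Subgroup.closure {x, y} := Subgroup.subset_closure (by simp)
  have hyH : y ∈ Subgroup.closure {x, y} := Subgroup.subset_closure (by simp)
  have hx1 : x ≠ 1 := by rintro rfl; simp at hxy
  have hy1 : y ≠ 1 := by rintro rfl; simp at hxy
  have ex : x⁻¹ = x := inv_eq_of_mul_eq_one_left hx
  have ey : y⁻¹ = y := inv_eq_of_mul_eq_one_left hy
  have b := braid_of_cube_eq_one hx hy (hG.cube_eq_one_of_not_comm hx hy hxy)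
  have hconj : ∀ g u : G, u * u = 1 → u ≠ 1 →
      g * u * g⁻¹ = x ∨ g * u * g⁻¹ = y ∨ g * u * g⁻¹ = x * y * x := by
    intro g u hu hu1
    refine hG.mem_of_mul_self hx hy ?_ hxy (by simpa using hu1)
    have : g * u * g⁻¹ * (g * u * g⁻¹) = g * (u * u) * g⁻¹ := by group
    rw [this, hu]
    simp
  -- a centralizer of `x` fixes `y` or swaps `y` and `xyx`, as `x` itself does
  have hfix : ∀ g : G, g * x * g⁻¹ = x → g ∈ Subgroup.closure {x, y} := by
    intro g hg
    have hgx : g * x = x * g := mul_inv_eq_iff_eq_mul.mp hg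
    rcases hconj g y hy hy1 with h | h | h
    · refine absurd ?_ hxy
      have : y = x := by
        have := h.trans hg.symm
        simpa using this
      rw [this]
    · rw [hG.eq_one_of_comm hx hy hxy hgx (mul_inv_eq_iff_eq_mul.mp h)]
      exact one_mem _
    · have hc : x * g * x = x * x * g := by rw [mul_assoc, hgx, mul_assoc]
      have hone : x * g = 1 := by
        refine hG.eq_one_of_comm hx hy hxy (by rw [hc, mul_assoc]) ?_
        rw [mul_inv_eq_iff_eq_mul] at h
        rw [mul_assoc, h, ← mul_assoc, ← mul_assoc, ← mul_assoc, hx, one_mul, mul_assoc]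
      rw [← mul_eq_one_iff_inv_eq.mp hone]
      exact inv_mem hxH
  rw [eq_top_iff]
  intro g _
  rcases hconj g x hx hx1 with h | h | h
  · exact hfix g h
  · have := hfix (x * y * x * g) (by
      have e : x * y * x * g * x * (x * y * x * g)⁻¹ =
        x * y * x * (g * x * g⁻¹) * (x⁻¹ * y⁻¹ * x⁻¹) := by group
      have e' : x * y * x * y * (x * y * x) = (x * y) ^ 3 * x := by
        simp only [pow_succ, pow_zero, one_mul, mul_assoc]
      rw [e, h, ex, ey, e', hG.cube_eq_one_of_not_comm hx hy hxy, one_mul])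
    exact (Subgroup.mul_mem_cancel_left _ (mul_mem (mul_mem hxH hyH) hxH)).mp this
  · have := hfix (y * g) (by
      have e : y * g * x * (y * g)⁻¹ = y * (g * x * g⁻¹) * y⁻¹ := by group
      rw [e, h, ey, ← b, mul_assoc y x y, ← mul_assoc, hy, one_mul, mul_assoc, hy, mul_one])
    exact (Subgroup.mul_mem_cancel_left _ hyH).mp this

end SymmetricSubgroups

/-! ### Dihedral groups and the symmetric group -/

/-- The rotation `r 1` is the product of two reflections. -/
theorem not_classA_three_dihedralGroup {n : ℕ} [NeZero n]
    (h2 : (DihedralGroup.r 1 : DihedralGroup n) ^ 2 ≠ 1)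
    (h3 : (DihedralGroup.r 1 : DihedralGroup n) ^ 3 ≠ 1) : ¬ ClassA 3 (DihedralGroup n) := by
  intro hG
  have := hG.sq_eq_one_or_cube_eq_one (x := .sr 0) (y := .sr 1) (by simp) (by simp)
    (by rw [DihedralGroup.one_def]; exact fun h => nomatch h)
    (by rw [DihedralGroup.one_def]; exact fun h => nomatch h)
  rw [DihedralGroup.sr_mul_sr, sub_zero] at this
  tauto

theorem proposition2p5 :
    (∀ (G : Type*) [Group G] [Fintype G], ClassA 3 G →
      ((∃ H : Subgroup G, Nonempty (H ≃* Equiv.Perm (Fin 3))) ↔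
        Nonempty (G ≃* Equiv.Perm (Fin 3)))) ∧
    ¬ ClassA 3 (DihedralGroup 4) ∧
    ¬ ClassA 3 (DihedralGroup 6) := by
  refine ⟨fun G _ _ hG => ⟨?_, fun ⟨e⟩ => ⟨⊤, ⟨Subgroup.topEquiv.trans e⟩⟩⟩,
    not_classA_three_dihedralGroup (by decide) (by decide),
    not_classA_three_dihedralGroup (by decide) (by decide)⟩
  rintro ⟨H, ⟨e⟩⟩
  obtain ⟨x, hx⟩ := e.surjective (Equiv.swap 0 1)
  obtain ⟨y, hy⟩ := e.surjective (Equiv.swap 1 2)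
  have h1 : (x : G) * x = 1 := by
    norm_cast
    rw [← e.map_eq_one_iff, map_mul, hx]
    decide
  have h2 : (y : G) * y = 1 := by
    norm_cast
    rw [← e.map_eq_one_iff, map_mul, hy]
    decide
  have h3 : (x : G) * y ≠ y * x := by
    intro h
    have h' := congrArg e (show x * y = y * x from Subtype.ext h)
    rw [map_mul, map_mul, hx, hy] at h'
    revert h'
    decide
  have hH : H = ⊤ := by
    rw [eq_top_iff, ← hG.closure_eq_top h1 h2 h3, Subgroup.closure_le]
    rintro _ (rfl | rfl)
    exacts [x.2, y.2]
  subst hH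
  exact ⟨Subgroup.topEquiv.symm.trans e⟩
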